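/- Consider a two-armed bandit with success probabilities $p_1,p_2\in[0,1]$: at each round $n\ge 1$ arm $j\in\{1,2\}$ carries a reward $A_n^j\sim\mathcal B(p_j)$, and the player selects an arm $I_n$ and receives $A_n^{I_n}$. Let $\sigma\in[0,1]$, let $(B_n)_{n\ge1}$ be i.i.d. $\mathcal B(\sigma)$ variables, and suppose that the variables $A_n^1,A_n^2,B_n$ ($n\ge1$) are mutually independent. For step sequences $(\gamma_n)_{n\ge1},(\rho_n)_{n\ge1}$, the two-armed $\sigma$-over-penalized Narendra–Shapiro algorithm starts from an initial value $X_0$ with values in $[0,1]$. For each $n\ge0$, the arm $I_{n+1}$ satisfies $$\mathbb P(I_{n+1}=1\mid\mathcal F_n)=X_n,\qquad \mathbb P(I_{n+1}=2\mid\mathcal F_n)=1-X_n,$$ where $\mathcal F_n$ is generated by $X_0$ and $(I_k,A_k^{I_k},B_k)_{1\le k\le n}$; the triple $(A_{n+1}^1,A_{n+1}^2,B_{n+1})$ is independent of $(\mathcal F_n,I_{n+1})$; and $$X_{n+1}=X_n+\gamma_{n+1}\big[\mathbf 1_{I_{n+1}=1}-X_n\big]A_{n+1}^{I_{n+1}}-\gamma_{n+1}\rho_{n+1}\big[X_n\mathbf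 1_{I_{n+1}=1}-(1-X_n)\mathbf 1_{I_{n+1}=2}\big]\big(1-A_{n+1}^{I_{n+1}}B_{n+1}\big).$$ Its pseudo-regret is $$\bar R_n=\max_{j\in\{1,2\}}\mathbb E\sum_{k=1}^n\big[A_k^j-A_k^{I_k}\big].$$ **Theorem.** (a) Let $\sigma\in[0,1)$, $(\gamma_1,\rho_1)\in(0,1)^2$, and $\gamma_n=\gamma_1/\sqrt n$, $\rho_n=\rho_1/\sqrt n$ for $n\ge1$. There is a constant $C_\sigma(\gamma_1,\rho_1)$, depending only on $\sigma,\gamma_1,\rho_1$ (in particular neither on $p_1,p_2$ nor on the initial value $X_0$), such that $$\forall n\in\mathbb N,\qquad \sup_{(p_1,p_2)\in[0,1]^2,\ p_2<p_1}\bar R_n\le C_\sigma(\gamma_1,\rho_1)\sqrt n.$$ (b) For $\sigma=0$ and $\gamma_n=2.63\,\rho_n=0.89/\sqrt n$, whatever the initial value $X_0$, $$\forall n\in\mathbb N,\qquad \sup_{(p_1,p_2)\in[0,1]^2,\ p_2<p_1}\bar R_n\le 31.1\sqrt{2n}.$$ -/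

import Mathlib

open MeasureTheory ProbabilityTheory

namespace NSBandit

/-- The step sequence `c / √n` (used for `n ≥ 1`). -/
noncomputable def invSqrtStep (c : ℝ) (n : ℕ) : ℝ := c / Real.sqrt n

/-- The information available to the player after round `n`: the initial weight `X₀` and, for each
round `1 ≤ k ≤ n`, the selected arm `I k`, the reward obtained with this arm and the auxiliary
variable `B k` used in the update. -/
@[reducible] def history {Ω : Type*} (A : Fin 2 → ℕ → Ω → ℝ) (B : ℕ → Ω → ℝ) (I : ℕ → Ω → Fin 2)
    (X₀ : Ω → ℝ) (n : ℕ) : MeasurableSpace Ω :=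
  MeasurableSpace.comap X₀ inferInstance ⊔
    ⨆ k ∈ Finset.Icc 1 n,
      MeasurableSpace.comap (fun ω => (I k ω, A (I k ω) k ω, B k ω)) inferInstance

/-- `(A, B, I, X)` is a run, on the probability space `(Ω, μ)`, of the two-armed `σ`-over-penalized
Narendra-Shapiro algorithm with step sequences `γ`, `ρ`. Arm 1 is `0 : Fin 2` and arm 2 is
`1 : Fin 2`; `p j` is the success probability of arm `j`; `A j n` is the reward attached to arm `j`
at round `n ≥ 1`; `B n` is the auxiliary Bernoulli variable of round `n`; `I n` is the arm selected
at round `n`; `X n` is the probability of drawing arm 1 at round `n + 1`. -/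
structure IsOverPenalizedNSa {Ω : Type*} [MeasurableSpace Ω] (μ : Measure Ω)
    (σ : unitInterval) (γ ρ : ℕ → ℝ) (p : Fin 2 → unitInterval)
    (A : Fin 2 → ℕ → Ω → ℝ) (B : ℕ → Ω → ℝ) (I : ℕ → Ω → Fin 2) (X : ℕ → Ω → ℝ) : Prop where
  measurable_A : ∀ j n, Measurable (A j n)
  measurable_B : ∀ n, Measurable (B n)
  measurable_I : ∀ n, Measurable (I n)
  measurable_X_zero : Measurable (X 0)
  /-- The initial weight is a probability. -/
  X_zero_mem : ∀ ω, X 0 ω ∈ Set.Icc (0 : ℝ) 1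
  /-- `A j n` is a Bernoulli variable with parameter `p j`. -/
  law_A : ∀ j n, HasLaw (A j (n + 1)) (bernoulliMeasure (1 : ℝ) 0 (p j)) μ
  /-- `B n` is a Bernoulli variable with parameter `σ`. -/
  law_B : ∀ n, HasLaw (B (n + 1)) (bernoulliMeasure (1 : ℝ) 0 σ) μ
  /-- All the variables `A j n` and `B n`, `n ≥ 1`, are mutually independent. -/
  indep_A_B : iIndepFun
    (Sum.elim (fun q : Fin 2 × ℕ => A q.1 (q.2 + 1)) (fun n : ℕ => B (n + 1))) μ
  /-- Given the past, arm 1 is selected at round `n + 1` with probability `X n`. -/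
  select : ∀ n,
    μ[Set.indicator {ω | I (n + 1) ω = 0} (fun _ => (1 : ℝ)) | history A B I (X 0) n] =ᵐ[μ] X n
  /-- The rewards and the auxiliary variable of round `n + 1` are independent of the past and of
  the choice of the arm at round `n + 1`. -/
  indep_past : ∀ n, Indep
    (MeasurableSpace.comap (fun ω => (A 0 (n + 1) ω, A 1 (n + 1) ω, B (n + 1) ω)) inferInstance)
    (history A B I (X 0) n ⊔ MeasurableSpace.comap (I (n + 1)) inferInstance) μ
  /-- The over-penalized update rule. -/
  update : ∀ n ω,
    X (n + 1) ω = X n ω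
      + γ (n + 1) * ((if I (n + 1) ω = 0 then 1 else 0) - X n ω) * A (I (n + 1) ω) (n + 1) ω
      - γ (n + 1) * ρ (n + 1)
        * (X n ω * (if I (n + 1) ω = 0 then 1 else 0)
            - (1 - X n ω) * (if I (n + 1) ω = 1 then 1 else 0))
        * (1 - A (I (n + 1) ω) (n + 1) ω * B (n + 1) ω)

/-- The pseudo-regret after `n` rounds: the maximum over the arms `j` of
`𝔼[∑_{k=1}^n (A_k^j - A_k^{I_k})]`. -/
noncomputable def pseudoRegret {Ω : Type*} [MeasurableSpace Ω] (μ : Measure Ω)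
    (A : Fin 2 → ℕ → Ω → ℝ) (I : ℕ → Ω → Fin 2) (n : ℕ) : ℝ :=
  Finset.univ.sup' Finset.univ_nonempty
    (fun j : Fin 2 => ∫ ω, ∑ k ∈ Finset.Icc 1 n, (A j k ω - A (I k ω) k ω) ∂μ)

end NSBandit

namespace NSBandit

/-! ### History and choice of the arm. -/

variable {Ω : Type*}

/-! Write `X` for the weight of the better arm and `δ = p 0 - p 1`. Conditioning each round on the
past bounds the regret by `δ ∑ 𝔼(1 - X)` (`pseudoRegret_le`), and two potentials control this sum.

The mean of `X` has drift at least `γ δ 𝔼[X(1 - X)] - γρ`. Since `X` stays in `[0, 1]`, summation by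
parts with weights `√n` gives `δ ∑ 𝔼[X(1 - X)] = O(√n)`, uniformly in `δ`
(`sum_integral_mul_one_sub_le`). This falls short of the goal only where `X` is near `0`.

There the penalty acts: its drift `γρ((1 - σ)(1 - X)² - X²)` pushes `X` away from `0` because `σ <
1`. It is measured by `n 𝔼[((c - X)⁺)²]`, whose factor `n` cancels the `1/n` of `γρ` and `γ²`. The
squared increments cost `γ² 𝔼[X(1 - X)]` plus a summable error of order `√n`
(`integral_sq_increment_le`), so a pointwise inequality in `x` yields `c² ∑ 𝔼(1 - X) ≤ K ∑ 𝔼[X(1 -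
X)] + O(√n)` (`sum_integral_one_sub_le`). Multiplying by `δ ≤ 1` and inserting the first bound
concludes. Both potentials vanish at `n = 0`, so the constants ignore `X 0`. -/

lemma fin_two_apply_eq (A : Fin 2 → ℕ → Ω → ℝ) (i : Fin 2) (n : ℕ) (ω : Ω) :
    A i n ω = if i = 0 then A 0 n ω else A 1 n ω := by
  fin_cases i <;> simp

lemma history_mono (A : Fin 2 → ℕ → Ω → ℝ) (B : ℕ → Ω → ℝ) (I : ℕ → Ω → Fin 2) (X₀ : Ω → ℝ) :
    Monotone (history A B I X₀) := by
  intro m n hmn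
  refine sup_le_sup le_rfl (biSup_mono fun k hk => ?_)
  simp only [Finset.mem_Icc] at hk ⊢
  exact ⟨hk.1, hk.2.trans hmn⟩

lemma measurable_history_round (A : Fin 2 → ℕ → Ω → ℝ) (B : ℕ → Ω → ℝ) (I : ℕ → Ω → Fin 2)
    (X₀ : Ω → ℝ) (n : ℕ) :
    Measurable[history A B I X₀ (n + 1)]
      (fun ω => (I (n + 1) ω, A (I (n + 1) ω) (n + 1) ω, B (n + 1) ω)) := by
  refine Measurable.mono (comap_measurable _) ?_ le_rfl
  refine le_trans ?_ le_sup_right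
  exact le_iSup₂_of_le (n + 1) (by simp) le_rfl

/-- Indicator of the event that arm `j` is selected at round `n`. -/
def selected (I : ℕ → Ω → Fin 2) (j : Fin 2) (n : ℕ) (ω : Ω) : ℝ := if I n ω = j then 1 else 0

lemma selected_zero_add_one (I : ℕ → Ω → Fin 2) (n : ℕ) (ω : Ω) :
    selected I 1 n ω = 1 - selected I 0 n ω := by
  rcases (by omega : I n ω = 0 ∨ I n ω = 1) with hI | hI <;> simp [selected, hI]

/-- The probability of selecting arm `j` when arm `1` has weight `x`. -/
def weight (j : Fin 2) (x : ℝ) : ℝ := if j = 0 then x else 1 - x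

/-! ### Measurability, range of the weight, conditioning on the past. -/

section Measurable

variable [MeasurableSpace Ω] {μ : Measure Ω} {σ : unitInterval} {γ ρ : ℕ → ℝ}
  {p : Fin 2 → unitInterval} {A : Fin 2 → ℕ → Ω → ℝ} {B : ℕ → Ω → ℝ} {I : ℕ → Ω → Fin 2}
  {X : ℕ → Ω → ℝ}

lemma IsOverPenalizedNSa.measurable_reward (h : IsOverPenalizedNSa μ σ γ ρ p A B I X) (n : ℕ) :
    Measurable (fun ω => A (I n ω) n ω) := by
  simp_rw [fun ω => fin_two_apply_eq A (I n ω) n ω]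
  exact Measurable.ite (h.measurable_I n (measurableSet_singleton 0))
    (h.measurable_A 0 n) (h.measurable_A 1 n)

lemma IsOverPenalizedNSa.history_le (h : IsOverPenalizedNSa μ σ γ ρ p A B I X) (n : ℕ) :
    history A B I (X 0) n ≤ ‹MeasurableSpace Ω› := by
  refine sup_le h.measurable_X_zero.comap_le (iSup₂_le fun k _ => ?_)
  exact ((h.measurable_I k).prodMk
    ((h.measurable_reward k).prodMk (h.measurable_B k))).comap_le

lemma IsOverPenalizedNSa.measurable_X (h : IsOverPenalizedNSa μ σ γ ρ p A B I X) (n : ℕ) :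
    Measurable[history A B I (X 0) n] (X n) := by
  induction n with
  | zero => exact Measurable.mono (comap_measurable _) le_sup_left le_rfl
  | succ n ih =>
    have hX : Measurable[history A B I (X 0) (n + 1)] (X n) :=
      ih.mono (history_mono A B I (X 0) n.le_succ) le_rfl
    have hr := measurable_history_round A B I (X 0) n
    have hf : Measurable (fun q : ℝ × (Fin 2 × ℝ × ℝ) => q.1
        + γ (n + 1) * ((if q.2.1 = 0 then 1 else 0) - q.1) * q.2.2.1
        - γ (n + 1) * ρ (n + 1)
          * (q.1 * (if q.2.1 = 0 then 1 else 0) - (1 - q.1) * (if q.2.1 = 1 then 1 else 0))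
          * (1 - q.2.2.1 * q.2.2.2)) := by
      have hsel : ∀ j : Fin 2, Measurable
          (fun q : ℝ × (Fin 2 × ℝ × ℝ) => if q.2.1 = j then (1 : ℝ) else 0) := fun j =>
        (measurable_of_finite fun i : Fin 2 => if i = j then (1 : ℝ) else 0).comp
          (measurable_fst.comp measurable_snd)
      have h0 := hsel 0
      have h1 := hsel 1
      fun_prop
    have : X (n + 1) = _ := funext (h.update n)
    rw [this]
    exact hf.comp (hX.prodMk hr)

lemma IsOverPenalizedNSa.measurable_X' (h : IsOverPenalizedNSa μ σ γ ρ p A B I X) (n : ℕ) :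
    Measurable (X n) := (h.measurable_X n).mono (h.history_le n) le_rfl

lemma ae_zero_or_one_of_hasLaw {Y : Ω → ℝ} {r : unitInterval}
    (hY : HasLaw Y (bernoulliMeasure (1 : ℝ) 0 r) μ) : ∀ᵐ ω ∂μ, Y ω = 0 ∨ Y ω = 1 := by
  have hm : MeasurableSet ({0, 1} : Set ℝ) := (Set.toFinite _).measurableSet
  have : ∀ᵐ y ∂(bernoulliMeasure (1 : ℝ) 0 r), y ∈ ({0, 1} : Set ℝ) := by
    rw [ae_iff]
    exact bernoulliMeasure_apply_of_notMem_of_notMem r hm.compl (by simp) (by simp)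
  rw [← hY.map_eq] at this
  simpa using ae_of_ae_map hY.aemeasurable this

lemma integral_of_hasLaw_bernoulli {Y : Ω → ℝ} {r : unitInterval}
    (hY : HasLaw Y (bernoulliMeasure (1 : ℝ) 0 r) μ) : ∫ ω, Y ω ∂μ = r := by
  rw [hY.integral_eq, integral_bernoulliMeasure]
  simp

/-- Only almost sure, because the rewards and `B` take values in `{0, 1}` only almost surely. -/
lemma IsOverPenalizedNSa.ae_X_mem (h : IsOverPenalizedNSa μ σ γ ρ p A B I X)
    (hγ : ∀ n, γ (n + 1) ∈ Set.Icc (0 : ℝ) 1) (hρ : ∀ n, ρ (n + 1) ∈ Set.Icc (0 : ℝ) 1) (n : ℕ) :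
    ∀ᵐ ω ∂μ, X n ω ∈ Set.Icc (0 : ℝ) 1 := by
  induction n with
  | zero => exact .of_forall h.X_zero_mem
  | succ n ih =>
    filter_upwards [ih, ae_zero_or_one_of_hasLaw (h.law_A 0 n),
      ae_zero_or_one_of_hasLaw (h.law_A 1 n), ae_zero_or_one_of_hasLaw (h.law_B n)]
      with ω hX hA0 hA1 hB
    obtain ⟨hg0, hg1⟩ := hγ n
    obtain ⟨hr0, hr1⟩ := hρ n
    obtain ⟨hx0, hx1⟩ := hX
    rw [h.update n ω]
    generalize X n ω = x at *
    generalize γ (n + 1) = g at *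
    generalize ρ (n + 1) = r at *
    have hgr0 : 0 ≤ g * r := mul_nonneg hg0 hr0
    have hgr1 : g * r ≤ 1 := mul_le_one₀ hg1 hr0 hr1
    have hy0 : 0 ≤ 1 - x := by linarith
    have a1 := mul_nonneg hg0 hx0
    have a2 := mul_nonneg hg0 hy0
    have a3 := mul_nonneg hgr0 hx0
    have a4 := mul_nonneg hgr0 hy0
    have a5 := mul_nonneg (sub_nonneg.2 hg1) hx0
    have a6 := mul_nonneg (sub_nonneg.2 hg1) hy0
    have a7 := mul_nonneg (sub_nonneg.2 hgr1) hx0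
    have a8 := mul_nonneg (sub_nonneg.2 hgr1) hy0
    rcases (by omega : I (n + 1) ω = 0 ∨ I (n + 1) ω = 1) with hI | hI <;> rw [hI]
    · rcases hA0 with hA | hA <;> rcases hB with hB | hB <;> rw [hA, hB] <;>
        constructor <;> norm_num <;> nlinarith
    · rcases hA1 with hA | hA <;> rcases hB with hB | hB <;> rw [hA, hB] <;>
        constructor <;> norm_num <;> nlinarith

lemma IsOverPenalizedNSa.measurable_selected (h : IsOverPenalizedNSa μ σ γ ρ p A B I X)
    (j : Fin 2) (n : ℕ) : Measurable (selected I j n) :=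
  (measurable_of_finite fun i : Fin 2 => if i = j then (1 : ℝ) else 0).comp (h.measurable_I n)

lemma memLp_top_selected [IsFiniteMeasure μ] (h : IsOverPenalizedNSa μ σ γ ρ p A B I X)
    (j : Fin 2) (n : ℕ) : MemLp (selected I j n) ⊤ μ := by
  refine memLp_top_of_bound (h.measurable_selected j n).aestronglyMeasurable 1 (.of_forall fun ω => ?_)
  unfold selected
  split_ifs <;> simp

/-- Tower property: `Z` is known from the past, so the selection indicator may be replaced by its
conditional expectation. -/
lemma integral_selected_mul [IsProbabilityMeasure μ] (h : IsOverPenalizedNSa μ σ γ ρ p A B I X)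
    (j : Fin 2) (n : ℕ) {Z : Ω → ℝ} (hZm : Measurable[history A B I (X 0) n] Z)
    (hZ : MemLp Z ⊤ μ) (hX : MemLp (X n) ⊤ μ) :
    ∫ ω, Z ω * selected I j (n + 1) ω ∂μ = ∫ ω, Z ω * weight j (X n ω) ∂μ := by
  have key : ∫ ω, Z ω * selected I 0 (n + 1) ω ∂μ = ∫ ω, Z ω * X n ω ∂μ := by
    have hs : selected I 0 (n + 1) =
        Set.indicator {ω | I (n + 1) ω = 0} (fun _ => (1 : ℝ)) := by
      ext ω; simp [selected, Set.indicator]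
    have hsi := memLp_top_selected h 0 (n + 1)
    have hp := condExp_mul_of_stronglyMeasurable_left (m := history A B I (X 0) n) (μ := μ)
      (f := Z) (g := selected I 0 (n + 1)) hZm.stronglyMeasurable
      ((hsi.mul hZ (r := ⊤)).integrable le_top) (hsi.integrable le_top)
    rw [← integral_condExp (h.history_le n) (f := fun ω => Z ω * selected I 0 (n + 1) ω)]
    refine integral_congr_ae ?_
    have hsel := h.select n
    rw [← hs] at hsel
    filter_upwards [hp, hsel] with ω h1 h2
    rw [← h2]
    exact h1
  have h0 := memLp_top_selected h 0 (n + 1)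
  rcases (by omega : j = 0 ∨ j = 1) with rfl | rfl
  · simpa [weight] using key
  · simp only [selected_zero_add_one, weight, one_ne_zero, if_false, mul_sub, mul_one]
    have e0 : Integrable (fun ω => Z ω * selected I 0 (n + 1) ω) μ :=
      (h0.mul hZ (r := ⊤)).integrable le_top
    have e1 : Integrable (fun ω => Z ω * X n ω) μ := (hX.mul hZ (r := ⊤)).integrable le_top
    rw [integral_sub (hZ.integrable le_top) e0, integral_sub (hZ.integrable le_top) e1, key]

/-- The rewards and the auxiliary variable of round `n + 1` factor out of expectations that involve
only the past and the choice of the arm. -/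
lemma integral_selected_mul_mul [IsProbabilityMeasure μ]
    (h : IsOverPenalizedNSa μ σ γ ρ p A B I X)
    (j : Fin 2) (n : ℕ) {Z V : Ω → ℝ} (hZm : Measurable[history A B I (X 0) n] Z)
    (hZ : MemLp Z ⊤ μ) (hX : MemLp (X n) ⊤ μ)
    (hV : Measurable[MeasurableSpace.comap
      (fun ω => (A 0 (n + 1) ω, A 1 (n + 1) ω, B (n + 1) ω)) inferInstance] V) :
    ∫ ω, Z ω * selected I j (n + 1) ω * V ω ∂μ
      = (∫ ω, Z ω * weight j (X n ω) ∂μ) * ∫ ω, V ω ∂μ := by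
  rw [← integral_selected_mul h j n hZm hZ hX]
  have hS : Measurable[history A B I (X 0) n ⊔ MeasurableSpace.comap (I (n + 1)) inferInstance]
      (selected I j (n + 1)) :=
    (measurable_of_finite fun i : Fin 2 => if i = j then (1 : ℝ) else 0).comp
      (Measurable.mono (comap_measurable (I (n + 1))) le_sup_right le_rfl)
  have hZS : Measurable[history A B I (X 0) n ⊔ MeasurableSpace.comap (I (n + 1)) inferInstance]
      (fun ω => Z ω * selected I j (n + 1) ω) :=
    (hZm.mono le_sup_left le_rfl).mul hS
  have hind : IndepFun (fun ω => Z ω * selected I j (n + 1) ω) V μ := by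
    rw [IndepFun_iff_Indep]
    exact indep_of_indep_of_le_left (indep_of_indep_of_le_right (h.indep_past n).symm
      hV.comap_le) hZS.comap_le
  have hVm : Measurable V := hV.mono (((h.measurable_A 0 _).prodMk
    ((h.measurable_A 1 _).prodMk (h.measurable_B _))).comap_le) le_rfl
  refine hind.integral_fun_mul_eq_mul_integral ?_ hVm.aestronglyMeasurable
  exact (hZ.aestronglyMeasurable).mul (h.measurable_selected j _).aestronglyMeasurable

end Measurable

lemma reward_eq {Ω : Type*} (A : Fin 2 → ℕ → Ω → ℝ) (I : ℕ → Ω → Fin 2) (n : ℕ) (ω : Ω) :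
    A (I n ω) n ω = selected I 0 n ω * A 0 n ω + selected I 1 n ω * A 1 n ω := by
  rcases (by omega : I n ω = 0 ∨ I n ω = 1) with hI | hI <;> simp [selected, hI]

/-! ### One-round moment estimates. -/

section Moments

variable {Ω : Type*} [MeasurableSpace Ω] {μ : Measure Ω}
  {σ : unitInterval} {γ ρ : ℕ → ℝ}
  {p : Fin 2 → unitInterval} {A : Fin 2 → ℕ → Ω → ℝ} {B : ℕ → Ω → ℝ} {I : ℕ → Ω → Fin 2}
  {X : ℕ → Ω → ℝ}

lemma memLp_top_mul {f g : Ω → ℝ} (hf : MemLp f ⊤ μ) (hg : MemLp g ⊤ μ) :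
    MemLp (fun ω => f ω * g ω) ⊤ μ := hg.mul hf

/-- Splits the move by arm and by reward or penalty. Each term is a product of past, choice and
fresh variables, the form required by `integral_selected_mul_mul`. -/
lemma IsOverPenalizedNSa.increment_eq (h : IsOverPenalizedNSa μ σ γ ρ p A B I X) (n : ℕ) (ω : Ω) :
    X (n + 1) ω - X n ω =
      γ (n + 1) * ((1 - X n ω) * selected I 0 (n + 1) ω * A 0 (n + 1) ω
          - X n ω * selected I 1 (n + 1) ω * A 1 (n + 1) ω)
        + γ (n + 1) * ρ (n + 1)
          * ((1 - X n ω) * selected I 1 (n + 1) ω * (1 - A 1 (n + 1) ω * B (n + 1) ω)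
            - X n ω * selected I 0 (n + 1) ω * (1 - A 0 (n + 1) ω * B (n + 1) ω)) := by
  rw [h.update n ω]
  rcases (by omega : I (n + 1) ω = 0 ∨ I (n + 1) ω = 1) with hI | hI <;>
    simp [selected, hI] <;> ring

lemma memLp_top_of_ae_mem_Icc [IsFiniteMeasure μ] {f : Ω → ℝ} (hm : Measurable f)
    (hf : ∀ᵐ ω ∂μ, f ω ∈ Set.Icc (0 : ℝ) 1) : MemLp f ⊤ μ := by
  refine memLp_top_of_bound hm.aestronglyMeasurable 1 ?_
  filter_upwards [hf] with ω h
  rw [Real.norm_eq_abs, abs_le]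
  constructor <;> linarith [h.1, h.2]

lemma memLp_top_of_hasLaw_bernoulli [IsFiniteMeasure μ] {Y : Ω → ℝ} {r : unitInterval} (hm : Measurable Y)
    (hY : HasLaw Y (bernoulliMeasure (1 : ℝ) 0 r) μ) : MemLp Y ⊤ μ := by
  refine memLp_top_of_ae_mem_Icc hm ?_
  filter_upwards [ae_zero_or_one_of_hasLaw hY] with ω h
  rcases h with h | h <;> simp [h]

lemma IsOverPenalizedNSa.memLp_A [IsFiniteMeasure μ]
    (h : IsOverPenalizedNSa μ σ γ ρ p A B I X) (j : Fin 2) (n : ℕ) :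
    MemLp (A j (n + 1)) ⊤ μ :=
  memLp_top_of_hasLaw_bernoulli (h.measurable_A j _) (h.law_A j n)

lemma IsOverPenalizedNSa.memLp_B [IsFiniteMeasure μ]
    (h : IsOverPenalizedNSa μ σ γ ρ p A B I X) (n : ℕ) :
    MemLp (B (n + 1)) ⊤ μ :=
  memLp_top_of_hasLaw_bernoulli (h.measurable_B _) (h.law_B n)

variable [IsProbabilityMeasure μ]

lemma memLp_top_one_sub {f : Ω → ℝ} (hf : MemLp f ⊤ μ) : MemLp (fun ω => 1 - f ω) ⊤ μ :=
  (memLp_const (1 : ℝ)).sub hf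

/-- Failure indicators `1 - A j B` enter the penalty with mean between `1 - σ` and `1`. -/
lemma IsOverPenalizedNSa.integral_penalty_mem (h : IsOverPenalizedNSa μ σ γ ρ p A B I X)
    (j : Fin 2) (n : ℕ) :
    ∫ ω, (1 - A j (n + 1) ω * B (n + 1) ω) ∂μ ∈ Set.Icc (1 - (σ : ℝ)) 1 := by
  have hA := h.memLp_A j n
  have hB := h.memLp_B n
  have hi : Integrable (fun ω => A j (n + 1) ω * B (n + 1) ω) μ :=
    (memLp_top_mul hA hB).integrable le_top
  rw [integral_sub (integrable_const _) hi]
  simp only [integral_const, probReal_univ, smul_eq_mul, mul_one, Set.mem_Icc]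
  have a1 := ae_zero_or_one_of_hasLaw (h.law_A j n)
  have a2 := ae_zero_or_one_of_hasLaw (h.law_B n)
  constructor
  · have : ∫ ω, A j (n + 1) ω * B (n + 1) ω ∂μ ≤ ∫ ω, B (n + 1) ω ∂μ := by
      refine integral_mono_ae hi (hB.integrable le_top) ?_
      filter_upwards [a1, a2] with ω h1 h2
      rcases h1 with h1 | h1 <;> rcases h2 with h2 | h2 <;> simp [h1, h2]
    rw [integral_of_hasLaw_bernoulli (h.law_B n)] at this
    linarith
  · have : 0 ≤ ∫ ω, A j (n + 1) ω * B (n + 1) ω ∂μ := by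
      refine integral_nonneg_of_ae ?_
      filter_upwards [a1, a2] with ω h1 h2
      rcases h1 with h1 | h1 <;> rcases h2 with h2 | h2 <;> simp [h1, h2]
    linarith

/-- Lower bound for the drift of the weight, tested against a nonnegative function of the past. -/
lemma IsOverPenalizedNSa.le_integral_mul_increment
    (h : IsOverPenalizedNSa μ σ γ ρ p A B I X)
    (hγ : ∀ n, γ (n + 1) ∈ Set.Icc (0 : ℝ) 1) (hρ : ∀ n, ρ (n + 1) ∈ Set.Icc (0 : ℝ) 1) (n : ℕ)
    {Z : Ω → ℝ} (hZm : Measurable[history A B I (X 0) n] Z) (hZ : MemLp Z ⊤ μ)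
    (hZ0 : ∀ ω, 0 ≤ Z ω) :
    γ (n + 1) * ((p 0 : ℝ) - p 1) * ∫ ω, Z ω * (X n ω * (1 - X n ω)) ∂μ
      + γ (n + 1) * ρ (n + 1)
        * ∫ ω, Z ω * ((1 - σ) * (1 - X n ω) ^ 2 - X n ω ^ 2) ∂μ
      ≤ ∫ ω, Z ω * (X (n + 1) ω - X n ω) ∂μ := by
  have hX : MemLp (X n) ⊤ μ := memLp_top_of_ae_mem_Icc (h.measurable_X' n) (h.ae_X_mem hγ hρ n)
  have hXm := h.measurable_X n
  have hY := memLp_top_one_sub hX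
  have hYm : Measurable[history A B I (X 0) n] (fun ω => 1 - X n ω) := hXm.const_sub 1
  have hZX := memLp_top_mul hZ hX
  have hZY := memLp_top_mul hZ hY
  have hZXm : Measurable[history A B I (X 0) n] (fun ω => Z ω * X n ω) := hZm.mul hXm
  have hZYm : Measurable[history A B I (X 0) n] (fun ω => Z ω * (1 - X n ω)) := hZm.mul hYm
  have hs := fun j => memLp_top_selected h j (n + 1)
  have hA := fun j => h.memLp_A j n
  have hP := fun j => memLp_top_one_sub (memLp_top_mul (hA j) (h.memLp_B n))
  have hround := comap_measurable (m := inferInstance) (fun ω => (A 0 (n + 1) ω, A 1 (n + 1) ω, B (n + 1) ω))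
  have hAm : ∀ j, Measurable[MeasurableSpace.comap
      (fun ω => (A 0 (n + 1) ω, A 1 (n + 1) ω, B (n + 1) ω)) inferInstance] (A j (n + 1)) := by
    intro j
    rcases (by omega : j = 0 ∨ j = 1) with rfl | rfl
    · exact measurable_fst.comp hround
    · exact (measurable_fst.comp measurable_snd).comp hround
  have hPm : ∀ j, Measurable[MeasurableSpace.comap
      (fun ω => (A 0 (n + 1) ω, A 1 (n + 1) ω, B (n + 1) ω)) inferInstance]
      (fun ω => 1 - A j (n + 1) ω * B (n + 1) ω) := fun j =>
    ((hAm j).mul ((measurable_snd.comp measurable_snd).comp hround)).const_sub 1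
  have e1 := integral_selected_mul_mul h 0 n hZYm hZY hX (hAm 0)
  have e2 := integral_selected_mul_mul h 1 n hZXm hZX hX (hAm 1)
  have e3 := integral_selected_mul_mul h 1 n hZYm hZY hX (hPm 1)
  have e4 := integral_selected_mul_mul h 0 n hZXm hZX hX (hPm 0)
  have i1 := (memLp_top_mul (memLp_top_mul hZY (hs 0)) (hA 0)).integrable le_top
  have i2 := (memLp_top_mul (memLp_top_mul hZX (hs 1)) (hA 1)).integrable le_top
  have i3 := (memLp_top_mul (memLp_top_mul hZY (hs 1)) (hP 1)).integrable le_top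
  have i4 := (memLp_top_mul (memLp_top_mul hZX (hs 0)) (hP 0)).integrable le_top
  rw [integral_of_hasLaw_bernoulli (h.law_A 0 n)] at e1
  rw [integral_of_hasLaw_bernoulli (h.law_A 1 n)] at e2
  simp only [weight, if_true, one_ne_zero, if_false] at e1 e2 e3 e4
  have split : ∫ ω, Z ω * (X (n + 1) ω - X n ω) ∂μ
      = γ (n + 1) * ((∫ ω, Z ω * (1 - X n ω) * selected I 0 (n + 1) ω * A 0 (n + 1) ω ∂μ)
          - ∫ ω, Z ω * X n ω * selected I 1 (n + 1) ω * A 1 (n + 1) ω ∂μ)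
        + γ (n + 1) * ρ (n + 1)
          * ((∫ ω, Z ω * (1 - X n ω) * selected I 1 (n + 1) ω
              * (1 - A 1 (n + 1) ω * B (n + 1) ω) ∂μ)
            - ∫ ω, Z ω * X n ω * selected I 0 (n + 1) ω
              * (1 - A 0 (n + 1) ω * B (n + 1) ω) ∂μ) := by
    have i5 := (i1.sub i2).const_mul (γ (n + 1))
    have i6 := (i3.sub i4).const_mul (γ (n + 1) * ρ (n + 1))
    simp only [Pi.sub_apply] at i5 i6
    rw [← integral_sub i1 i2, ← integral_sub i3 i4, ← integral_const_mul, ← integral_const_mul,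
      ← integral_add i5 i6]
    refine integral_congr_ae (.of_forall fun ω => ?_)
    simp only [h.increment_eq]
    ring
  have hXX := (memLp_top_mul hZX hX).integrable le_top
  have hYY := (memLp_top_mul hZY hY).integrable le_top
  have split' : ∫ ω, Z ω * ((1 - σ) * (1 - X n ω) ^ 2 - X n ω ^ 2) ∂μ
      = (1 - σ) * (∫ ω, Z ω * (1 - X n ω) * (1 - X n ω) ∂μ) - ∫ ω, Z ω * X n ω * X n ω ∂μ := by
    rw [← integral_const_mul, ← integral_sub (hYY.const_mul _) hXX]
    refine integral_congr_ae (.of_forall fun ω => ?_)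
    simp only
    ring
  have c1 : ∫ ω, Z ω * (1 - X n ω) * X n ω ∂μ = ∫ ω, Z ω * (X n ω * (1 - X n ω)) ∂μ :=
    integral_congr_ae (.of_forall fun ω => by simp only; ring)
  have c2 : ∫ ω, Z ω * X n ω * (1 - X n ω) ∂μ = ∫ ω, Z ω * (X n ω * (1 - X n ω)) ∂μ :=
    integral_congr_ae (.of_forall fun ω => by simp only; ring)
  have n1 : 0 ≤ ∫ ω, Z ω * (1 - X n ω) * (1 - X n ω) ∂μ :=
    integral_nonneg fun ω => by
      simp only [mul_assoc]; exact mul_nonneg (hZ0 ω) (mul_self_nonneg _)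
  have n2 : 0 ≤ ∫ ω, Z ω * X n ω * X n ω ∂μ :=
    integral_nonneg fun ω => by
      simp only [mul_assoc]; exact mul_nonneg (hZ0 ω) (mul_self_nonneg _)
  rw [split, split', e1, e2, e3, e4, c1, c2]
  -- Penalizing arm `1` raises `X`, so its mean is bounded below by `1 - σ`; penalizing arm `0`
  -- lowers `X`, so its mean is bounded above by `1`.
  have b1 := mul_le_mul_of_nonneg_left (h.integral_penalty_mem 1 n).1 n1
  have b0 := mul_le_mul_of_nonneg_left (h.integral_penalty_mem 0 n).2 n2
  have hgr := mul_nonneg (hγ n).1 (hρ n).1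
  have := mul_le_mul_of_nonneg_left (add_le_add b1 (neg_le_neg b0)) hgr
  linarith

/-- For the arm played, reward and penalty push in opposite directions, so the cross term of the
square can be dropped. The reward part averages to `γ²((1 - x)² x + x² (1 - x)) = γ² x(1 - x)`. -/
lemma IsOverPenalizedNSa.integral_sq_increment_le
    (h : IsOverPenalizedNSa μ σ γ ρ p A B I X)
    (hγ : ∀ n, γ (n + 1) ∈ Set.Icc (0 : ℝ) 1) (hρ : ∀ n, ρ (n + 1) ∈ Set.Icc (0 : ℝ) 1) (n : ℕ) :
    ∫ ω, (X (n + 1) ω - X n ω) ^ 2 ∂μ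
      ≤ γ (n + 1) ^ 2 * (∫ ω, X n ω * (1 - X n ω) ∂μ) + (γ (n + 1) * ρ (n + 1)) ^ 2 := by
  have hX := fun n => memLp_top_of_ae_mem_Icc (h.measurable_X' n) (h.ae_X_mem hγ hρ n)
  have hXm := h.measurable_X n
  have hY := memLp_top_one_sub (hX n)
  have hYm : Measurable[history A B I (X 0) n] (fun ω => 1 - X n ω) := hXm.const_sub 1
  have hs := fun j => memLp_top_selected h j (n + 1)
  have e0 := integral_selected_mul h 0 n (hYm.mul hYm) (memLp_top_mul hY hY) (hX n)
  have e1 := integral_selected_mul h 1 n (hXm.mul hXm) (memLp_top_mul (hX n) (hX n)) (hX n)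
  have i0 := (memLp_top_mul (memLp_top_mul hY hY) (hs 0)).integrable le_top
  have i1 := (memLp_top_mul (memLp_top_mul (hX n) (hX n)) (hs 1)).integrable le_top
  simp only [weight, if_true, one_ne_zero, if_false, Pi.mul_apply] at e0 e1
  have j0 := (memLp_top_mul (memLp_top_mul hY hY) (hX n)).integrable le_top
  have j1 := (memLp_top_mul (memLp_top_mul (hX n) (hX n)) hY).integrable le_top
  have hD := (hX (n + 1)).sub (hX n)
  have hD2 : Integrable (fun ω => (X (n + 1) ω - X n ω) ^ 2) μ := by
    simp only [sq]
    exact (memLp_top_mul hD hD).integrable le_top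
  have hw : ∫ ω, X n ω * (1 - X n ω) ∂μ
      = (∫ ω, (1 - X n ω) * (1 - X n ω) * selected I 0 (n + 1) ω ∂μ)
        + ∫ ω, X n ω * X n ω * selected I 1 (n + 1) ω ∂μ := by
    rw [e0, e1, ← integral_add j0 j1]
    refine integral_congr_ae (.of_forall fun ω => ?_)
    simp only
    ring
  have hr : γ (n + 1) ^ 2 * (∫ ω, X n ω * (1 - X n ω) ∂μ) + (γ (n + 1) * ρ (n + 1)) ^ 2
      = ∫ ω, (γ (n + 1) ^ 2 * ((1 - X n ω) * (1 - X n ω) * selected I 0 (n + 1) ω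
        + X n ω * X n ω * selected I 1 (n + 1) ω) + (γ (n + 1) * ρ (n + 1)) ^ 2) ∂μ := by
    have i2 : Integrable (fun ω => γ (n + 1) ^ 2 *
        ((1 - X n ω) * (1 - X n ω) * selected I 0 (n + 1) ω
          + X n ω * X n ω * selected I 1 (n + 1) ω)) μ := (i0.add i1).const_mul _
    rw [integral_add i2 (integrable_const _), integral_const_mul, integral_add i0 i1, hw]
    simp
  rw [hr]
  refine integral_mono_ae hD2 (((i0.add i1).const_mul _).add (integrable_const _)) ?_
  filter_upwards [h.ae_X_mem hγ hρ n, ae_zero_or_one_of_hasLaw (h.law_A 0 n),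
    ae_zero_or_one_of_hasLaw (h.law_A 1 n), ae_zero_or_one_of_hasLaw (h.law_B n)]
    with ω hx hA0 hA1 hB
  have hg := (hγ n).1
  have hr := (hρ n).1
  rw [h.update n ω]
  obtain ⟨hx0, hx1⟩ := hx
  generalize X n ω = x at *
  generalize γ (n + 1) = g at *
  generalize ρ (n + 1) = r at *
  have key : ∀ u v a b : ℝ, 0 ≤ u → 0 ≤ v → v ≤ 1 → (a = 0 ∨ a = 1) → (b = 0 ∨ b = 1) →
      (g * u * a - g * r * v * (1 - a * b)) ^ 2 ≤ g ^ 2 * (u * u) + (g * r) ^ 2 := by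
    intro u v a b hu hv hv1 ha hb
    have h1 : 0 ≤ g * u * (g * r * v) := by positivity
    have h2 : (g * r * v) ^ 2 ≤ (g * r) ^ 2 := by
      rw [mul_pow]
      exact mul_le_of_le_one_right (sq_nonneg _) (pow_le_one₀ hv hv1)
    rcases ha with rfl | rfl <;> rcases hb with rfl | rfl <;>
      nlinarith [sq_nonneg (g * u), sq_nonneg (g * r)]
  rcases (by omega : I (n + 1) ω = 0 ∨ I (n + 1) ω = 1) with hI | hI
  · have := key (1 - x) x _ _ (by linarith) hx0 hx1 hA0 hB
    simp only [hI, selected, if_true, zero_ne_one, if_false]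
    refine le_of_eq_of_le ?_ (this.trans_eq ?_) <;> ring
  · have := key x (1 - x) _ _ hx0 (by linarith) (by linarith) hA1 hB
    simp only [hI, selected, if_true, one_ne_zero, if_false]
    refine le_of_eq_of_le ?_ (this.trans_eq ?_) <;> ring

/-- The expected weight increases up to the penalization. -/
lemma IsOverPenalizedNSa.le_integral_X_succ
    (h : IsOverPenalizedNSa μ σ γ ρ p A B I X)
    (hγ : ∀ n, γ (n + 1) ∈ Set.Icc (0 : ℝ) 1) (hρ : ∀ n, ρ (n + 1) ∈ Set.Icc (0 : ℝ) 1) (n : ℕ) :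
    (∫ ω, X n ω ∂μ) + γ (n + 1) * ((p 0 : ℝ) - p 1) * (∫ ω, X n ω * (1 - X n ω) ∂μ)
      - γ (n + 1) * ρ (n + 1) ≤ ∫ ω, X (n + 1) ω ∂μ := by
  have hX := fun n => memLp_top_of_ae_mem_Icc (h.measurable_X' n) (h.ae_X_mem hγ hρ n)
  have hd := h.le_integral_mul_increment hγ hρ n (Z := fun _ => 1) measurable_const
    (memLp_const 1) (fun _ => zero_le_one)
  simp only [one_mul] at hd
  rw [integral_sub ((hX _).integrable le_top) ((hX _).integrable le_top)] at hd
  have hi : Integrable (fun ω => (1 - (σ : ℝ)) * (1 - X n ω) ^ 2 - X n ω ^ 2) μ := by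
    have hY := memLp_top_one_sub (hX n)
    simp only [sq]
    exact (((memLp_top_mul hY hY).integrable le_top).const_mul _).sub
      ((memLp_top_mul (hX n) (hX n)).integrable le_top)
  have hlow : -1 ≤ ∫ ω, ((1 - (σ : ℝ)) * (1 - X n ω) ^ 2 - X n ω ^ 2) ∂μ := by
    have : ∫ _ : Ω, (-1 : ℝ) ∂μ = -1 := by simp
    rw [← this]
    refine integral_mono_ae (integrable_const _) hi ?_
    filter_upwards [h.ae_X_mem hγ hρ n] with ω hx
    have h1 : 0 ≤ (1 - (σ : ℝ)) * (1 - X n ω) ^ 2 :=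
      mul_nonneg (sub_nonneg.2 σ.2.2) (sq_nonneg _)
    have h2 : X n ω ^ 2 ≤ 1 := pow_le_one₀ hx.1 hx.2
    linarith
  have := mul_le_mul_of_nonneg_left hlow (mul_nonneg (hγ n).1 (hρ n).1)
  linarith

/-- One-step evolution of the truncated second moment `𝔼[((c - X)⁺)²]`. -/
lemma IsOverPenalizedNSa.integral_sq_posPart_succ_le
    (h : IsOverPenalizedNSa μ σ γ ρ p A B I X)
    (hγ : ∀ n, γ (n + 1) ∈ Set.Icc (0 : ℝ) 1) (hρ : ∀ n, ρ (n + 1) ∈ Set.Icc (0 : ℝ) 1)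
    (hp : p 1 < p 0) (c : ℝ) (n : ℕ) :
    ∫ ω, max (c - X (n + 1) ω) 0 ^ 2 ∂μ ≤
      (∫ ω, max (c - X n ω) 0 ^ 2 ∂μ)
        - 2 * (γ (n + 1) * ρ (n + 1)) *
          (∫ ω, max (c - X n ω) 0 * ((1 - σ) * (1 - X n ω) ^ 2 - X n ω ^ 2) ∂μ)
        + γ (n + 1) ^ 2 * (∫ ω, X n ω * (1 - X n ω) ∂μ) + (γ (n + 1) * ρ (n + 1)) ^ 2 := by
  have hX := fun n => memLp_top_of_ae_mem_Icc (h.measurable_X' n) (h.ae_X_mem hγ hρ n)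
  have hg : ∀ n, MemLp (fun ω => max (c - X n ω) 0) ⊤ μ := fun n =>
    ((memLp_const c).sub (hX n)).pos_part
  have hgm : Measurable[history A B I (X 0) n] (fun ω => max (c - X n ω) 0) :=
    ((h.measurable_X n).const_sub c).max measurable_const
  have hd := h.le_integral_mul_increment hγ hρ n hgm (hg n) (fun ω => le_max_right _ _)
  have hq := h.integral_sq_increment_le hγ hρ n
  -- The reward drift has the favourable sign and is discarded, which keeps the estimate independent
  -- of the gap.
  have hw : 0 ≤ ∫ ω, max (c - X n ω) 0 * (X n ω * (1 - X n ω)) ∂μ := by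
    refine integral_nonneg_of_ae ?_
    filter_upwards [h.ae_X_mem hγ hρ n] with ω hx
    exact mul_nonneg (le_max_right _ _) (mul_nonneg hx.1 (sub_nonneg.2 hx.2))
  have hw' := mul_nonneg (mul_nonneg (hγ n).1
    (sub_nonneg.2 (Subtype.coe_le_coe.2 hp.le) : 0 ≤ (p 0 : ℝ) - p 1)) hw
  have hD := (hX (n + 1)).sub (hX n)
  have i1 := (memLp_top_mul (hg n) (hg n)).integrable le_top
  have i1' := (memLp_top_mul (hg (n + 1)) (hg (n + 1))).integrable le_top
  have i2 : Integrable (fun ω => max (c - X n ω) 0 * (X (n + 1) ω - X n ω)) μ :=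
    (memLp_top_mul (hg n) hD).integrable le_top
  have i3 : Integrable (fun ω => (X (n + 1) ω - X n ω) * (X (n + 1) ω - X n ω)) μ :=
    (memLp_top_mul hD hD).integrable le_top
  simp only [← sq] at i1 i1' i3
  -- `x ↦ ((c - x)⁺)²` has the `2`-Lipschitz derivative `-2(c - x)⁺`, hence lies below its quadratic
  -- Taylor bound.
  have hmono : ∫ ω, max (c - X (n + 1) ω) 0 ^ 2 ∂μ ≤
      (∫ ω, max (c - X n ω) 0 ^ 2 ∂μ)
        - 2 * (∫ ω, max (c - X n ω) 0 * (X (n + 1) ω - X n ω) ∂μ)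
        + ∫ ω, (X (n + 1) ω - X n ω) ^ 2 ∂μ := by
    have i4 : Integrable (fun ω => max (c - X n ω) 0 ^ 2
        - 2 * (max (c - X n ω) 0 * (X (n + 1) ω - X n ω))) μ := i1.sub (i2.const_mul 2)
    rw [← integral_const_mul, ← integral_sub i1 (i2.const_mul 2), ← integral_add i4 i3]
    refine integral_mono i1' (i4.add i3) fun ω => ?_
    simp only
    generalize X n ω = x
    generalize X (n + 1) ω = y
    rcases max_cases (c - x) 0 with ⟨h1, h2⟩ | ⟨h1, h2⟩ <;>
      rcases max_cases (c - y) 0 with ⟨h3, h4⟩ | ⟨h3, h4⟩ <;> rw [h1, h3] <;> nlinarith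
  linarith

/-- Each round played on the worse arm costs the gap on average; round `k + 1` is drawn with weight
`X k`, hence the index shift. -/
lemma IsOverPenalizedNSa.pseudoRegret_le
    (h : IsOverPenalizedNSa μ σ γ ρ p A B I X)
    (hγ : ∀ n, γ (n + 1) ∈ Set.Icc (0 : ℝ) 1) (hρ : ∀ n, ρ (n + 1) ∈ Set.Icc (0 : ℝ) 1)
    (hp : p 1 < p 0) (n : ℕ) :
    pseudoRegret μ A I n
      ≤ ((p 0 : ℝ) - p 1) * ∑ k ∈ Finset.range n, ∫ ω, (1 - X k ω) ∂μ := by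
  have hX := fun n => memLp_top_of_ae_mem_Icc (h.measurable_X' n) (h.ae_X_mem hγ hρ n)
  have hp' : (p 1 : ℝ) < p 0 := hp
  refine Finset.sup'_le _ _ fun j _ => ?_
  have hR : ∀ m, Integrable (fun ω => A (I (m + 1) ω) (m + 1) ω) μ := fun m => by
    simp only [reward_eq]
    exact ((memLp_top_mul (memLp_top_selected h 0 _) (h.memLp_A 0 m)).add
      (memLp_top_mul (memLp_top_selected h 1 _) (h.memLp_A 1 m))).integrable le_top
  have hstep : ∀ m, ∫ ω, (A j (m + 1) ω - A (I (m + 1) ω) (m + 1) ω) ∂μ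
      ≤ ((p 0 : ℝ) - p 1) * ∫ ω, (1 - X m ω) ∂μ := by
    intro m
    have hround := comap_measurable (m := inferInstance) (fun ω => (A 0 (m + 1) ω, A 1 (m + 1) ω, B (m + 1) ω))
    have e0 := integral_selected_mul_mul h 0 m (Z := fun _ => 1) measurable_const (memLp_const 1)
      (hX m) (V := A 0 (m + 1)) (measurable_fst.comp hround)
    have e1 := integral_selected_mul_mul h 1 m (Z := fun _ => 1) measurable_const (memLp_const 1)
      (hX m) (V := A 1 (m + 1)) ((measurable_fst.comp measurable_snd).comp hround)
    simp only [one_mul, weight, if_true, one_ne_zero, if_false] at e0 e1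
    rw [integral_sub ((h.memLp_A j m).integrable le_top) (hR m)]
    simp only [reward_eq]
    rw [integral_add
      ((memLp_top_mul (memLp_top_selected h 0 _) (h.memLp_A 0 m)).integrable le_top)
      ((memLp_top_mul (memLp_top_selected h 1 _) (h.memLp_A 1 m)).integrable le_top), e0, e1,
      integral_of_hasLaw_bernoulli (h.law_A j m), integral_of_hasLaw_bernoulli (h.law_A 0 m),
      integral_of_hasLaw_bernoulli (h.law_A 1 m),
      integral_sub (integrable_const _) ((hX m).integrable le_top)]
    simp only [integral_const, probReal_univ, smul_eq_mul, mul_one]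
    have : (p j : ℝ) ≤ p 0 := by
      rcases (by omega : j = 0 ∨ j = 1) with rfl | rfl
      exacts [le_rfl, hp'.le]
    linarith
  rw [integral_finsetSum]
  · induction n with
    | zero => simp
    | succ n ih =>
      rw [Finset.sum_Icc_succ_top (by omega), Finset.sum_range_succ, mul_add]
      exact add_le_add ih (hstep n)
  · intro k hk
    obtain ⟨m, rfl⟩ : ∃ m, k = m + 1 := ⟨k - 1, by have := (Finset.mem_Icc.1 hk).1; omega⟩
    exact ((h.memLp_A j m).integrable le_top).sub (hR m)

end Moments

/-! ### Summation over the rounds for steps of order `1/√n`. -/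

lemma invSqrtStep_succ_mem_Icc {c : ℝ} (hc : c ∈ Set.Ioo (0 : ℝ) 1) (n : ℕ) :
    invSqrtStep c (n + 1) ∈ Set.Icc (0 : ℝ) 1 := by
  have h1 : 1 ≤ Real.sqrt ((n + 1 : ℕ) : ℝ) := Real.one_le_sqrt.2 (by simp)
  exact ⟨div_nonneg hc.1.le (Real.sqrt_nonneg _), (div_le_one (by linarith)).2 (hc.2.le.trans h1)⟩

/-- The increment of the square root is `1/(√(n+1) + √n)`. Telescoping, the inverse square roots sum
to at most `2√n`. -/
lemma inv_sqrt_succ_le (n : ℕ) :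
    1 / Real.sqrt ((n + 1 : ℕ) : ℝ) ≤ 2 * (Real.sqrt ((n + 1 : ℕ) : ℝ) - Real.sqrt n) := by
  have h0 := Real.sqrt_nonneg (n : ℝ)
  have h1 : 1 ≤ Real.sqrt ((n + 1 : ℕ) : ℝ) := Real.one_le_sqrt.2 (by simp)
  have h2 := Real.sq_sqrt (Nat.cast_nonneg (α := ℝ) n)
  have h3 := Real.sq_sqrt (Nat.cast_nonneg (α := ℝ) (n + 1))
  push_cast at h1 h3 ⊢
  rw [div_le_iff₀ (by linarith)]
  nlinarith [sq_nonneg (Real.sqrt (n + 1 : ℝ) - Real.sqrt n)]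

section Regret

variable {Ω : Type*} [MeasurableSpace Ω] {μ : Measure Ω} [IsProbabilityMeasure μ]
  {σ : unitInterval} {γ₁ ρ₁ : ℝ}
  {p : Fin 2 → unitInterval} {A : Fin 2 → ℕ → Ω → ℝ} {B : ℕ → Ω → ℝ} {I : ℕ → Ω → Fin 2}
  {X : ℕ → Ω → ℝ}

/-- Dividing the drift inequality for the mean by `γ` leaves increments of `𝔼 X` weighted by
`√(n+1)/γ₁`, summed by parts. -/
lemma IsOverPenalizedNSa.sum_integral_mul_one_sub_le
    (h : IsOverPenalizedNSa μ σ (invSqrtStep γ₁) (invSqrtStep ρ₁) p A B I X)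
    (hγ : γ₁ ∈ Set.Ioo (0 : ℝ) 1) (hρ : ρ₁ ∈ Set.Ioo (0 : ℝ) 1) (n : ℕ) :
    ((p 0 : ℝ) - p 1) * ∑ k ∈ Finset.range n, ∫ ω, X k ω * (1 - X k ω) ∂μ
      ≤ (1 / γ₁ + 2 * ρ₁) * Real.sqrt n := by
  have hγ' := invSqrtStep_succ_mem_Icc hγ
  have hρ' := invSqrtStep_succ_mem_Icc hρ
  have hX := fun n => memLp_top_of_ae_mem_Icc (h.measurable_X' n) (h.ae_X_mem hγ' hρ' n)
  have hx0 : ∀ n, 0 ≤ ∫ ω, X n ω ∂μ := fun n => integral_nonneg_of_ae <| by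
    filter_upwards [h.ae_X_mem hγ' hρ' n] with ω hx using hx.1
  have hx1 : ∀ n, ∫ ω, X n ω ∂μ ≤ 1 := fun n => by
    have : ∫ _ : Ω, (1 : ℝ) ∂μ = 1 := by simp
    rw [← this]
    refine integral_mono_ae ((hX n).integrable le_top) (integrable_const _) ?_
    filter_upwards [h.ae_X_mem hγ' hρ' n] with ω hx using hx.2
  have main : ((p 0 : ℝ) - p 1) * ∑ k ∈ Finset.range n, ∫ ω, X k ω * (1 - X k ω) ∂μ
      ≤ 1 / γ₁ * (Real.sqrt n * ∫ ω, X n ω ∂μ) + 2 * ρ₁ * Real.sqrt n := by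
    induction n with
    | zero => simp
    | succ n ih =>
      rw [Finset.sum_range_succ, mul_add]
      have hd := h.le_integral_X_succ hγ' hρ' n
      have hs := inv_sqrt_succ_le n
      have hs0 : 0 < Real.sqrt ((n + 1 : ℕ) : ℝ) := Real.sqrt_pos.2 (by positivity)
      have hmono : Real.sqrt n ≤ Real.sqrt ((n + 1 : ℕ) : ℝ) :=
        Real.sqrt_le_sqrt (by push_cast; linarith)
      simp only [invSqrtStep] at hd
      generalize Real.sqrt ((n + 1 : ℕ) : ℝ) = s at *
      have hstep : ((p 0 : ℝ) - p 1) * ∫ ω, X n ω * (1 - X n ω) ∂μ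
          ≤ 1 / γ₁ * (s * ((∫ ω, X (n + 1) ω ∂μ) - ∫ ω, X n ω ∂μ)) + ρ₁ * (1 / s) := by
        have e : ((p 0 : ℝ) - p 1) * (∫ ω, X n ω * (1 - X n ω) ∂μ)
            = s / γ₁ * (γ₁ / s * ((p 0 : ℝ) - p 1) * ∫ ω, X n ω * (1 - X n ω) ∂μ) := by
          have := hγ.1.ne'
          field_simp
        have e' : 1 / γ₁ * (s * ((∫ ω, X (n + 1) ω ∂μ) - ∫ ω, X n ω ∂μ)) + ρ₁ * (1 / s)
            = s / γ₁ * ((∫ ω, X (n + 1) ω ∂μ) - (∫ ω, X n ω ∂μ) + γ₁ / s * (ρ₁ / s)) := by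
          have := hγ.1.ne'
          field_simp
        rw [e, e']
        exact mul_le_mul_of_nonneg_left (by linarith) (div_nonneg hs0.le hγ.1.le)
      have h1 := mul_le_mul_of_nonneg_left hs hρ.1.le
      -- Summation by parts: replacing `s 𝔼[X n]` by the smaller `√n 𝔼[X n]` makes the sum
      -- telescope.
      have h2 := mul_le_mul_of_nonneg_left (mul_le_mul_of_nonneg_right hmono (hx0 n))
        (one_div_nonneg.2 hγ.1.le)
      linarith
  have h2 := mul_le_mul_of_nonneg_left
    (mul_le_mul_of_nonneg_left (hx1 n) (Real.sqrt_nonneg (n : ℝ))) (one_div_nonneg.2 hγ.1.le)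
  linarith

/-- Bound on the cumulated weight of the suboptimal arm, given a pointwise inequality for the drift
of the truncated second moment. -/
lemma IsOverPenalizedNSa.sum_integral_one_sub_le
    (h : IsOverPenalizedNSa μ σ (invSqrtStep γ₁) (invSqrtStep ρ₁) p A B I X)
    (hγ : γ₁ ∈ Set.Ioo (0 : ℝ) 1) (hρ : ρ₁ ∈ Set.Ioo (0 : ℝ) 1) (hp : p 1 < p 0) {c K : ℝ}
    (hK : ∀ x ∈ Set.Icc (0 : ℝ) 1,
      max (c - x) 0 ^ 2 - 2 * (γ₁ * ρ₁) * (max (c - x) 0 * ((1 - σ) * (1 - x) ^ 2 - x ^ 2))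
        + γ₁ ^ 2 * (x * (1 - x)) ≤ K * (x * (1 - x)) - c ^ 2 * (1 - x)) (n : ℕ) :
    c ^ 2 * ∑ k ∈ Finset.range n, ∫ ω, (1 - X k ω) ∂μ
      ≤ K * (∑ k ∈ Finset.range n, ∫ ω, X k ω * (1 - X k ω) ∂μ)
        + 2 * (γ₁ * ρ₁) ^ 2 * Real.sqrt n := by
  have hγ' := invSqrtStep_succ_mem_Icc hγ
  have hρ' := invSqrtStep_succ_mem_Icc hρ
  have hX := fun n => memLp_top_of_ae_mem_Icc (h.measurable_X' n) (h.ae_X_mem hγ' hρ' n)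
  -- The potential `n 𝔼[((c - X n)⁺)²]` is carried through the induction and dropped at the end by
  -- positivity.
  have main : c ^ 2 * (∑ k ∈ Finset.range n, ∫ ω, (1 - X k ω) ∂μ)
        + n * ∫ ω, max (c - X n ω) 0 ^ 2 ∂μ
      ≤ K * (∑ k ∈ Finset.range n, ∫ ω, X k ω * (1 - X k ω) ∂μ)
        + 2 * (γ₁ * ρ₁) ^ 2 * Real.sqrt n := by
    induction n with
    | zero => simp
    | succ n ih =>
      have hY := memLp_top_one_sub (hX n)
      have hg : MemLp (fun ω => max (c - X n ω) 0) ⊤ μ := ((memLp_const c).sub (hX n)).pos_part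
      have hq : MemLp (fun ω => (1 - (σ : ℝ)) * (1 - X n ω) ^ 2 - X n ω ^ 2) ⊤ μ := by
        simp only [sq]
        exact ((memLp_top_mul hY hY).const_mul _).sub (memLp_top_mul (hX n) (hX n))
      have i1 : Integrable (fun ω => max (c - X n ω) 0 ^ 2) μ := by
        simp only [sq]
        exact (memLp_top_mul hg hg).integrable le_top
      have i2 := ((memLp_top_mul hg hq).integrable le_top).const_mul (2 * (γ₁ * ρ₁))
      have i3 := (memLp_top_mul (hX n) hY).integrable le_top
      have i12 := i1.sub i2
      simp only [Pi.sub_def] at i12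
      have iY := hY.integrable le_top
      have hpt : (∫ ω, max (c - X n ω) 0 ^ 2 ∂μ)
          - 2 * (γ₁ * ρ₁) *
            (∫ ω, max (c - X n ω) 0 * ((1 - σ) * (1 - X n ω) ^ 2 - X n ω ^ 2) ∂μ)
          + γ₁ ^ 2 * (∫ ω, X n ω * (1 - X n ω) ∂μ)
          ≤ K * (∫ ω, X n ω * (1 - X n ω) ∂μ) - c ^ 2 * ∫ ω, (1 - X n ω) ∂μ := by
        simp only [← integral_const_mul]
        rw [← integral_sub i1 i2, ← integral_add i12 (i3.const_mul _),
          ← integral_sub (i3.const_mul _) (iY.const_mul _)]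
        refine integral_mono_ae (i12.add (i3.const_mul _))
          ((i3.const_mul _).sub (iY.const_mul _)) ?_
        filter_upwards [h.ae_X_mem hγ' hρ' n] with ω hx using hK _ hx
      have hd := h.integral_sq_posPart_succ_le hγ' hρ' hp c n
      have hs := inv_sqrt_succ_le n
      have hs1 : 1 ≤ Real.sqrt ((n + 1 : ℕ) : ℝ) := Real.one_le_sqrt.2 (by simp)
      have hsq : Real.sqrt ((n + 1 : ℕ) : ℝ) ^ 2 = (n : ℝ) + 1 := by
        rw [Real.sq_sqrt (Nat.cast_nonneg _)]; push_cast; ring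
      rw [Finset.sum_range_succ, Finset.sum_range_succ, Nat.cast_succ]
      simp only [invSqrtStep] at hd
      push_cast at hs hs1 hsq hd ⊢
      generalize Real.sqrt ((n : ℝ) + 1) = s at *
      have hs0 : 0 < s := by linarith
      have e1 : ((n : ℝ) + 1) * (γ₁ / s * (ρ₁ / s)) = γ₁ * ρ₁ := by rw [← hsq]; field_simp
      have e2 : ((n : ℝ) + 1) * (γ₁ / s) ^ 2 = γ₁ ^ 2 := by rw [← hsq]; field_simp
      -- The exact error is of order `1/(n+1)`; bounding it by `1/√(n+1)` is enough.
      have e3 : ((n : ℝ) + 1) * (γ₁ / s * (ρ₁ / s)) ^ 2 ≤ (γ₁ * ρ₁) ^ 2 * (1 / s) := by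
        have : ((n : ℝ) + 1) * (γ₁ / s * (ρ₁ / s)) ^ 2 = (γ₁ * ρ₁) ^ 2 * (1 / s * (1 / s)) := by
          rw [← hsq]; field_simp
        rw [this]
        refine mul_le_mul_of_nonneg_left ?_ (sq_nonneg _)
        exact mul_le_of_le_one_right (by positivity) ((div_le_one hs0).2 hs1)
      have e4 := mul_le_mul_of_nonneg_left hs (sq_nonneg (γ₁ * ρ₁))
      have hm := mul_le_mul_of_nonneg_left hd (by positivity : (0 : ℝ) ≤ (n : ℝ) + 1)
      generalize ∫ ω, max (c - X (n + 1) ω) 0 ^ 2 ∂μ = G' at *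
      generalize ∫ ω, max (c - X n ω) 0 ^ 2 ∂μ = G at *
      generalize ∫ ω, max (c - X n ω) 0 * ((1 - σ) * (1 - X n ω) ^ 2 - X n ω ^ 2) ∂μ = Q at *
      generalize ∫ ω, X n ω * (1 - X n ω) ∂μ = w at *
      have hm' : ((n : ℝ) + 1) * (G - 2 * (γ₁ / s * (ρ₁ / s)) * Q + (γ₁ / s) ^ 2 * w
            + (γ₁ / s * (ρ₁ / s)) ^ 2)
          = n * G + (G - 2 * (((n : ℝ) + 1) * (γ₁ / s * (ρ₁ / s))) * Q
            + ((n : ℝ) + 1) * (γ₁ / s) ^ 2 * w) + ((n : ℝ) + 1) * (γ₁ / s * (ρ₁ / s)) ^ 2 := by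
        ring
      rw [hm', e1, e2] at hm
      linarith
  have h0 : 0 ≤ n * ∫ ω, max (c - X n ω) 0 ^ 2 ∂μ :=
    mul_nonneg (Nat.cast_nonneg _) (integral_nonneg fun ω => sq_nonneg _)
  linarith

lemma IsOverPenalizedNSa.pseudoRegret_le_sqrt
    (h : IsOverPenalizedNSa μ σ (invSqrtStep γ₁) (invSqrtStep ρ₁) p A B I X)
    (hγ : γ₁ ∈ Set.Ioo (0 : ℝ) 1) (hρ : ρ₁ ∈ Set.Ioo (0 : ℝ) 1) (hp : p 1 < p 0) {c K : ℝ}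
    (hc : 0 < c) (hK0 : 0 ≤ K)
    (hK : ∀ x ∈ Set.Icc (0 : ℝ) 1,
      max (c - x) 0 ^ 2 - 2 * (γ₁ * ρ₁) * (max (c - x) 0 * ((1 - σ) * (1 - x) ^ 2 - x ^ 2))
        + γ₁ ^ 2 * (x * (1 - x)) ≤ K * (x * (1 - x)) - c ^ 2 * (1 - x)) (n : ℕ) :
    pseudoRegret μ A I n
      ≤ (K * (1 / γ₁ + 2 * ρ₁) + 2 * (γ₁ * ρ₁) ^ 2) / c ^ 2 * Real.sqrt n := by
  have h1 := h.pseudoRegret_le (invSqrtStep_succ_mem_Icc hγ) (invSqrtStep_succ_mem_Icc hρ) hp n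
  have h2 := h.sum_integral_one_sub_le hγ hρ hp hK n
  have h3 := h.sum_integral_mul_one_sub_le hγ hρ n
  have hp0 : 0 ≤ (p 0 : ℝ) - p 1 := sub_nonneg.2 hp.le
  have hp1 : (p 0 : ℝ) - p 1 ≤ 1 := by linarith [(p 0).2.2, (p 1).2.1]
  refine h1.trans ?_
  rw [div_mul_eq_mul_div, le_div_iff₀ (by positivity)]
  have h4 := mul_le_mul_of_nonneg_left h2 hp0
  have h5 := mul_le_mul_of_nonneg_left h3 hK0
  -- The gap is absorbed by the first bound in the main term; in the error term `δ ≤ 1` suffices.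
  have h6 := mul_le_mul_of_nonneg_right hp1
    (by positivity : 0 ≤ 2 * (γ₁ * ρ₁) ^ 2 * Real.sqrt n)
  linarith

end Regret

/-! ### Pointwise inequalities for the truncated drift. -/

/-- The drift inequality for the truncated second moment, with truncation level
`γ₁ ρ₁ (1 - σ)`. -/
lemma truncated_drift_le {a q g x : ℝ} (ha0 : 0 < a) (ha1 : a < 1) (hq0 : 0 < q) (hq1 : q ≤ 1)
    (hx : x ∈ Set.Icc (0 : ℝ) 1) :
    max (a * q - x) 0 ^ 2 - 2 * a * (max (a * q - x) 0 * (q * (1 - x) ^ 2 - x ^ 2))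
        + g ^ 2 * (x * (1 - x))
      ≤ (6 / (1 - a * q) + g ^ 2) * (x * (1 - x)) - (a * q) ^ 2 * (1 - x) := by
  obtain ⟨hx0, hx1⟩ := hx
  obtain ⟨c, hc⟩ : ∃ c, c = a * q := ⟨_, rfl⟩
  have hc0 : 0 < c := hc ▸ mul_pos ha0 hq0
  have hca : c ≤ a := hc ▸ mul_le_of_le_one_right ha0.le hq1
  have hx1' : 0 ≤ 1 - x := sub_nonneg.2 hx1
  rw [← hc]
  have hK6 : 6 ≤ 6 / (1 - c) := by rw [le_div_iff₀ (by linarith)]; linarith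
  have hKc : 6 / (1 - c) * (1 - c) = 6 := div_mul_cancel₀ _ (by linarith)
  generalize 6 / (1 - c) = L at *
  rcases le_total c x with hcx | hcx
  · rw [max_eq_right (by linarith)]
    have : c ^ 2 * (1 - x) ≤ L * x * (1 - x) := by
      refine mul_le_mul_of_nonneg_right ?_ hx1'
      nlinarith
    linarith
  · rw [max_eq_left (by linarith)]
    -- The level `c = a q` gives equality at `x = 0`, where `c² - 2acq = -c²`; the remainder is thus
    -- divisible by `x`.
    have e : (c - x) ^ 2 - 2 * a * ((c - x) * (q * (1 - x) ^ 2 - x ^ 2))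
        = -c ^ 2 * (1 - x)
          + x * (3 * c ^ 2 + (1 - 4 * c) * x + 2 * (a - c) * (x * (c - x))) := by
      have : a * q = c := hc.symm
      linear_combination (-2 * (c - x) * (1 - x) ^ 2) * this
    have b1 : 6 ≤ L * (1 - x) := by nlinarith
    -- The three summands are at most `3`, `1` and `2`, whence the constant `6`; the factor `1/(1 -
    -- c)` compensates `1 - x ≥ 1 - c`.
    have b2 : 3 * c ^ 2 + (1 - 4 * c) * x + 2 * (a - c) * (x * (c - x)) ≤ 6 := by
      have t1 : c ^ 2 ≤ 1 := by nlinarith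
      have t2 : 0 ≤ c * x := by positivity
      have t3 : (a - c) * (x * (c - x)) ≤ 1 := by
        refine mul_le_one₀ (by linarith) (mul_nonneg hx0 (by linarith)) ?_
        exact mul_le_one₀ hx1 (by linarith) (by linarith)
      nlinarith
    have b3 := mul_le_mul_of_nonneg_left (b2.trans b1) hx0
    linarith

/-- Sharper drift inequality without auxiliary variable, for `γ₁ ρ₁ ≤ 1 / 3`. -/
lemma truncated_drift_le_of_le_third {c g x : ℝ} (hc0 : 0 < c) (hc3 : 3 * c ≤ 1)
    (hx : x ∈ Set.Icc (0 : ℝ) 1) :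
    max (c - x) 0 ^ 2 - 2 * c * (max (c - x) 0 * ((1 - x) ^ 2 - x ^ 2)) + g ^ 2 * (x * (1 - x))
      ≤ (c + g ^ 2) * (x * (1 - x)) - c ^ 2 * (1 - x) := by
  obtain ⟨hx0, hx1⟩ := hx
  have hx1' : 0 ≤ 1 - x := sub_nonneg.2 hx1
  rcases le_total c x with hcx | hcx
  · rw [max_eq_right (by linarith)]
    have := mul_nonneg (mul_nonneg hc0.le (sub_nonneg.2 hcx)) hx1'
    linarith
  · rw [max_eq_left (by linarith)]
    -- The difference of the two sides is exactly `x (1 - 3c)(c - x)`.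
    have := mul_nonneg hx0 (mul_nonneg (sub_nonneg.2 hc3) (sub_nonneg.2 hcx))
    linarith

end NSBandit

/-! ### The two regret bounds. -/

theorem mainTheorem1 :
    (∀ (σ : unitInterval) (γ₁ ρ₁ : ℝ), (σ : ℝ) < 1 →
      γ₁ ∈ Set.Ioo (0 : ℝ) 1 → ρ₁ ∈ Set.Ioo (0 : ℝ) 1 →
      ∃ C : ℝ, ∀ (Ω : Type*) [MeasurableSpace Ω] (μ : Measure Ω) [IsProbabilityMeasure μ]
        (p : Fin 2 → unitInterval) (A : Fin 2 → ℕ → Ω → ℝ) (B : ℕ → Ω → ℝ)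
        (I : ℕ → Ω → Fin 2) (X : ℕ → Ω → ℝ),
        p 1 < p 0 →
        NSBandit.IsOverPenalizedNSa μ σ (NSBandit.invSqrtStep γ₁) (NSBandit.invSqrtStep ρ₁)
          p A B I X →
        ∀ n : ℕ, NSBandit.pseudoRegret μ A I n ≤ C * Real.sqrt n) ∧
    (∀ (Ω : Type*) [MeasurableSpace Ω] (μ : Measure Ω) [IsProbabilityMeasure μ]
        (p : Fin 2 → unitInterval) (A : Fin 2 → ℕ → Ω → ℝ) (B : ℕ → Ω → ℝ)
        (I : ℕ → Ω → Fin 2) (X : ℕ → Ω → ℝ),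
        p 1 < p 0 →
        NSBandit.IsOverPenalizedNSa μ 0 (NSBandit.invSqrtStep 0.89)
          (NSBandit.invSqrtStep (0.89 / 2.63)) p A B I X →
        ∀ n : ℕ, NSBandit.pseudoRegret μ A I n ≤ 31.1 * Real.sqrt (2 * n)) := by
  constructor
  · intro σ γ₁ ρ₁ hσ hγ hρ
    have hq0 : 0 < 1 - (σ : ℝ) := sub_pos.2 hσ
    have hq1 : 1 - (σ : ℝ) ≤ 1 := by linarith [σ.2.1]
    have ha0 : 0 < γ₁ * ρ₁ := mul_pos hγ.1 hρ.1
    have ha1 : γ₁ * ρ₁ < 1 := mul_lt_one_of_nonneg_of_lt_one_left hγ.1.le hγ.2 hρ.2.le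
    have hc1 : γ₁ * ρ₁ * (1 - σ) < 1 := (mul_le_of_le_one_right ha0.le hq1).trans_lt ha1
    -- Unification fills in the constant of `pseudoRegret_le_sqrt` with `c = γ₁ρ₁(1 - σ)` and `K =
    -- 6/(1 - c) + γ₁²`.
    refine ⟨_, fun Ω _ μ _ p A B I X hp h n => h.pseudoRegret_le_sqrt hγ hρ hp
      (mul_pos ha0 hq0) (add_nonneg (div_nonneg (by norm_num) (sub_nonneg.2 hc1.le)) (sq_nonneg γ₁))
      (fun x hx => NSBandit.truncated_drift_le ha0 ha1 hq0 hq1 hx) n⟩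
  · intro Ω _ μ _ p A B I X hp h n
    have hγ : (0.89 : ℝ) ∈ Set.Ioo (0 : ℝ) 1 := by constructor <;> norm_num
    have hρ : (0.89 / 2.63 : ℝ) ∈ Set.Ioo (0 : ℝ) 1 := by constructor <;> norm_num
    have key := h.pseudoRegret_le_sqrt hγ hρ hp (c := 0.89 * (0.89 / 2.63))
      (K := 0.89 * (0.89 / 2.63) + 0.89 ^ 2) (by norm_num) (by norm_num)
      (fun x hx => by
        simpa using NSBandit.truncated_drift_le_of_le_third (c := 0.89 * (0.89 / 2.63))
          (g := 0.89) (by norm_num) (by norm_num) hx) n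
    refine key.trans ?_
    rw [Real.sqrt_mul (by norm_num), ← mul_assoc]
    refine mul_le_mul_of_nonneg_right ?_ (Real.sqrt_nonneg _)
    -- The constant in `key` is about `23.7`, so a crude lower bound for `√2` is ample.
    have h2 : (1.4 : ℝ) ≤ Real.sqrt 2 := Real.le_sqrt_of_sq_le (by norm_num)
    refine le_trans ?_ (mul_le_mul_of_nonneg_left h2 (by norm_num))
    norm_num
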